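/- Let $f=f_0+f_1u+\dots+f_mu^m\in\mathbb{Z}[u^{\pm1}]$, $m>0$, $f_m>0$, $f_0\neq0$, be irreducible, with set of complex roots $\Omega_f$. Put $\Omega_f^{-}=\{\omega\in\Omega_f:|\omega|<1\}$, $\Omega_f^{(0)}=\{\omega\in\Omega_f:|\omega|=1\}$, $\Omega_f^{+}=\{\omega\in\Omega_f:|\omega|>1\}$, and assume that $\Omega_f^{(0)}\neq\varnothing$ and that $\Omega_f^{(0)}$ contains no root of unity. *Notation.* Let $\bar\sigma$ be the shift $(\bar\sigma w)_n=w_{n+1}$ on two-sided sequences, $f(\bar\sigma)=\sum_k f_k\bar\sigma^k$, and let $\rho:\mathbb{R}^{\mathbb{Z}}\to\mathbb{T}^{\mathbb{Z}}$ (with $\mathbb{T}=\mathbb{R}/\mathbb{Z}$) be coordinatewise reduction modulo $1$. All sequence spaces carry the topology of coordinatewise convergence and its Borel $\sigma$-algebra. Let $X=\{x\in\mathbb{T}^{\mathbb{Z}}:\sum_n f_nx_{k+n}=0\text{ for all }k\in\mathbb{Z}\}$, let $\alpha$ be the restriction of the shift to $X$, let $\ell^\infty(\mathbb{Z},\mathbb{Z})$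 be the group of bounded two-sided integer sequences, $W_f^{(0)}=\{w\in\ell^\infty(\mathbb{Z},\mathbb{R}):f(\bar\sigma)w=0\}$ and $X^{(0)}=\rho(W_f^{(0)})\subset X$. Write $\frac1{f(u)}=\frac1{f_m}\sum_{\omega\in\Omega_f}\frac{b_\omega}{u-\omega}$ (partial fractions) and define $$w^{\Delta_+}_n=\begin{cases}\frac1{f_m}\sum_{\omega\in\Omega_f^-}b_\omega\omega^{n-1}&(n\ge1)\\-\frac1{f_m}\sum_{\omega\in\Omega_f^{(0)}\cup\Omega_f^+}b_\omega\omega^{n-1}&(n\le0)\end{cases}\qquad w^{\Delta_-}_n=\begin{cases}\frac1{f_m}\sum_{\omega\in\Omega_f^-\cup\Omega_f^{(0)}}b_\omega\omega^{n-1}&(n\ge1)\\-\frac1{f_m}\sum_{\omega\in\Omega_f^+}b_\omega\omega^{n-1}&(n\le0).\end{cases}$$ For $v\in\ell^\infty(\mathbb{Z},\mathbb{Z})$ let $\bar\xi^*(v)=\sum_{n\ge0}v_n\bar\sigma^{-n}w^{\Delta_-}+\sum_{n<0}v_n\bar\sigma^{-n}w^{\Delta_+}$ (coordinatewise convergent),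 $\xi^*(v)=\rho(\bar\xi^*(v))\in X$, and $\mathsf d(n,v)=\bar\sigma^n\bar\xi^*(v)-\bar\xi^*(\bar\sigma^nv)\in W_f^{(0)}$ for $n\in\mathbb{Z}$. Let $\tilde Y=\ell^\infty(\mathbb{Z},\mathbb{Z})\times W_f^{(0)}$, $\tilde\sigma(v,w)=(\bar\sigma v,\bar\sigma w+\mathsf d(1,v))$, and let $\tilde\pi:\tilde Y\to\ell^\infty(\mathbb{Z},\mathbb{Z})$ be the first coordinate projection. **Theorem.** For every $\bar\sigma$-invariant Borel probability measure $\nu$ on $\ell^\infty(\mathbb{Z},\mathbb{Z})$ the following conditions are equivalent. 1. There exists a $\tilde\sigma$-invariant probability measure $\tilde\nu$ on $\tilde Y$ with $\tilde\pi_*\tilde\nu=\nu$. 2. For every $\varepsilon>0$ there exists a compact set $C_\varepsilon\subset W_f^{(0)}$ with $\nu(\{v:\mathsf d(k,v)\in C_\varepsilon\})>1-\varepsilon$ for every $k\in\mathbb{Z}$. 3. There exists a Borel map $\mathsf b:\ell^\infty(\mathbb{Z},\mathbb{Z})\to W_f^{(0)}$ with $\mathsf d(1,v)=\mathsf b(\bar\sigma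 v)-\bar\sigma\mathsf b(v)$ for $\nu$-a.e. $v$. Moreover, for every Borel map $\mathsf b$ as in (3), the map $\xi^*_{\mathsf b}:\ell^\infty(\mathbb{Z},\mathbb{Z})\to X$, $\xi^*_{\mathsf b}(v)=\xi^*(v)+\rho(\mathsf b(v))$, is Borel and satisfies $\xi^*_{\mathsf b}(v)-\xi^*(v)\in X^{(0)}$ for every $v$ and $\xi^*_{\mathsf b}\circ\bar\sigma=\alpha\circ\xi^*_{\mathsf b}$ $\nu$-a.e., and the probability measure $\mu=(\xi^*_{\mathsf b})_*\nu$ on $X$ is $\alpha$-invariant. -/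

import Mathlib

open Polynomial MeasureTheory

noncomputable section

namespace NonexpansiveCoding

/-! ### Shifts and polynomials in the shift -/

/-- The `n`-th power of the shift on two-sided sequences: `(σⁿ w)_k = w_{k+n}`. -/
def shift {A : Type*} (n : ℤ) (w : ℤ → A) : ℤ → A := fun k => w (k + n)

/-- The group homomorphism `f(σ) = ∑_k f_k σᵏ` on two-sided sequences. -/
def polyShift {A : Type*} [AddCommGroup A] (f : ℤ[X]) : (ℤ → A) →+ (ℤ → A) where
  toFun w := fun n => ∑ k ∈ f.support, f.coeff k • w (n + k)
  map_zero' := by ext; simp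
  map_add' w w' := by ext; simp [Finset.sum_add_distrib]

lemma polyShift_apply {A : Type*} [AddCommGroup A] (f : ℤ[X]) (w : ℤ → A) (n : ℤ) :
    polyShift f w n = ∑ k ∈ f.support, f.coeff k • w (n + k) := rfl

lemma polyShift_shift {A : Type*} [AddCommGroup A] (f : ℤ[X]) (n : ℤ) (w : ℤ → A) :
    polyShift f (shift n w) = shift n (polyShift f w) := by
  ext k
  simp only [polyShift_apply, shift]
  refine Finset.sum_congr rfl fun i _ => ?_
  rw [add_right_comm]

/-! ### The sequence spaces

All sequence spaces are subtypes of products over `ℤ`; they carry the topology of coordinatewise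
convergence and the corresponding (Borel) product `σ`-algebra. -/

/-- `ℓ^∞(ℤ, ℤ)`: the bounded two-sided sequences of integers. -/
def BddIntSeq : AddSubgroup (ℤ → ℤ) where
  carrier := {v | ∃ C : ℤ, ∀ n, |v n| ≤ C}
  zero_mem' := ⟨0, by simp⟩
  add_mem' := by
    rintro v w ⟨C, hC⟩ ⟨D, hD⟩
    exact ⟨C + D, fun n => (abs_add_le _ _).trans (add_le_add (hC n) (hD n))⟩
  neg_mem' := by
    rintro v ⟨C, hC⟩
    exact ⟨C, fun n => by simpa using hC n⟩

/-- The `n`-th power of the shift on `ℓ^∞(ℤ, ℤ)`. -/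
def shiftInt (n : ℤ) (v : BddIntSeq) : BddIntSeq :=
  ⟨shift n v.1, by obtain ⟨C, hC⟩ := v.2; exact ⟨C, fun k => hC _⟩⟩

/-- `W_f^{(0)}`: the bounded real two-sided sequences `w` with `f(σ) w = 0`. -/
def W0 (f : ℤ[X]) : Submodule ℝ (ℤ → ℝ) where
  carrier := {w | (∃ C : ℝ, ∀ n, |w n| ≤ C) ∧ polyShift f w = 0}
  zero_mem' := ⟨⟨0, by simp⟩, map_zero _⟩
  add_mem' := by
    rintro v w ⟨⟨C, hC⟩, hv⟩ ⟨⟨D, hD⟩, hw⟩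
    exact ⟨⟨C + D, fun n => (abs_add_le _ _).trans (add_le_add (hC n) (hD n))⟩,
      by rw [map_add, hv, hw, add_zero]⟩
  smul_mem' := by
    rintro c w ⟨⟨C, hC⟩, hw⟩
    refine ⟨⟨|c| * C, fun n => ?_⟩, ?_⟩
    · simpa [abs_mul] using mul_le_mul_of_nonneg_left (hC n) (abs_nonneg c)
    · ext n
      have h := congrFun hw n
      simp only [polyShift_apply, Pi.zero_apply, zsmul_eq_mul, Pi.smul_apply, smul_eq_mul] at h ⊢
      rw [← mul_zero c, ← h, Finset.mul_sum]
      exact Finset.sum_congr rfl fun k _ => by ring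

lemma shift_mem_W0 {f : ℤ[X]} (n : ℤ) {w : ℤ → ℝ} (hw : w ∈ W0 f) : shift n w ∈ W0 f := by
  obtain ⟨⟨C, hC⟩, h⟩ := hw
  refine ⟨⟨C, fun k => hC _⟩, ?_⟩
  rw [polyShift_shift, h]
  rfl

/-- The shift on `W_f^{(0)}`. -/
def shiftW0 (f : ℤ[X]) (w : W0 f) : W0 f := ⟨shift 1 w.1, shift_mem_W0 1 w.2⟩

/-! ### The compact group `X` and its automorphism -/

/-- The compact group `X = ker f(τ) ⊆ 𝕋^ℤ`, where `τ` is the shift on `𝕋^ℤ`. -/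
def XGroup (f : ℤ[X]) : AddSubgroup (ℤ → UnitAddCircle) := (polyShift f).ker

/-- The automorphism `α` of `X`: the restriction of the shift `τ`. -/
def alpha (f : ℤ[X]) (x : XGroup f) : XGroup f :=
  ⟨shift 1 x.1, by
    have h : polyShift f x.1 = 0 := x.2
    change polyShift f (shift 1 x.1) = 0
    rw [polyShift_shift, h]
    rfl⟩

/-- Coordinatewise reduction modulo one, `ρ^* : ℝ^ℤ → 𝕋^ℤ`. -/
def rho : (ℤ → ℝ) →+ (ℤ → UnitAddCircle) where
  toFun w := fun n => (w n : UnitAddCircle)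
  map_zero' := by ext; simp
  map_add' w w' := by ext; simp

lemma polyShift_rho (f : ℤ[X]) (w : ℤ → ℝ) : polyShift f (rho w) = rho (polyShift f w) := by
  ext n
  change ∑ k ∈ f.support, f.coeff k • ((w (n + k) : ℝ) : UnitAddCircle)
    = ((∑ k ∈ f.support, f.coeff k • w (n + k) : ℝ) : UnitAddCircle)
  rw [← QuotientAddGroup.mk'_apply (AddSubgroup.zmultiples (1 : ℝ)), map_sum]
  exact Finset.sum_congr rfl fun k _ => ((QuotientAddGroup.mk' (AddSubgroup.zmultiples (1 : ℝ))).map_zsmul _ _).symm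

/-- The restriction of `ρ^*` to `W_f^{(0)}`, as a homomorphism into `X`. -/
def rhoW0 (f : ℤ[X]) : W0 f →+ XGroup f where
  toFun w := ⟨rho w.1, by
    change polyShift f (rho w.1) = 0
    rw [polyShift_rho, w.2.2, map_zero]⟩
  map_zero' := Subtype.ext (map_zero rho)
  map_add' w w' := Subtype.ext (map_add rho w.1 w'.1)

/-- The central subgroup `X^{(0)} = ρ(W_f^{(0)})` of `X`. -/
def X0 (f : ℤ[X]) : AddSubgroup (XGroup f) := (rhoW0 f).range

/-! ### The roots of `f` -/

/-- `Ω_f`: the set of complex roots of `f`. -/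
def Omega (f : ℤ[X]) : Finset ℂ := (f.aroots ℂ).toFinset

open Classical in
/-- `Ω_f^-`: the roots of absolute value less than one. -/
def OmegaNeg (f : ℤ[X]) : Finset ℂ := {ω ∈ Omega f | ‖ω‖ < 1}

open Classical in
/-- `Ω_f^{(0)}`: the roots of absolute value one. -/
def OmegaZero (f : ℤ[X]) : Finset ℂ := {ω ∈ Omega f | ‖ω‖ = 1}

open Classical in
/-- `Ω_f^+`: the roots of absolute value greater than one. -/
def OmegaPos (f : ℤ[X]) : Finset ℂ := {ω ∈ Omega f | 1 < ‖ω‖}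

/-- `f` is nonhyperbolic if it has a root of absolute value one. -/
def IsNonhyperbolic (f : ℤ[X]) : Prop := (OmegaZero f).Nonempty

/-- `f` is cyclotomic if one of its roots (of absolute value one) is a root of unity. -/
def IsCyclotomic (f : ℤ[X]) : Prop := ∃ ω ∈ OmegaZero f, ∃ n : ℕ, 0 < n ∧ ω ^ n = 1

/-- `f = f_0 + ⋯ + f_m u^m` is irreducible in the ring `ℤ[u, u⁻¹]` of Laurent polynomials and
normalized so that `m > 0`, `f_m > 0` and `f_0 ≠ 0`. -/
structure IsNormalizedIrreducible (f : ℤ[X]) : Prop where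
  irreducible : Irreducible (toLaurent f)
  natDegree_pos : 0 < f.natDegree
  leadingCoeff_pos : 0 < f.leadingCoeff
  coeff_zero_ne_zero : f.coeff 0 ≠ 0

/-! ### The fundamental solutions `w^{Δ₊}`, `w^{Δ₋}` and `w^{Δ₀}` -/

open Classical in
/-- The coefficient `b_ω` in the partial fraction decomposition
`1 / f(u) = (1 / f_m) ∑_{ω ∈ Ω_f} b_ω / (u - ω)`; see `partialFraction`. -/
def residue (f : ℤ[X]) (ω : ℂ) : ℂ := ∏ ω' ∈ (Omega f).erase ω, (ω - ω')⁻¹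

/-- `(1 / f_m) ∑_{ω ∈ S} b_ω ω^{n-1}`. -/
def expSum (f : ℤ[X]) (S : Finset ℂ) (n : ℤ) : ℂ :=
  (f.leadingCoeff : ℂ)⁻¹ * ∑ ω ∈ S, residue f ω * ω ^ (n - 1)

/-- `w^{Δ₊}`. The sums are real, as the sets of roots are stable under conjugation; the real part
only changes the type. -/
def wPlus (f : ℤ[X]) (n : ℤ) : ℝ :=
  if 1 ≤ n then (expSum f (OmegaNeg f) n).re
  else -(expSum f (OmegaZero f) n + expSum f (OmegaPos f) n).re

/-- `w^{Δ₋}`. -/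
def wMinus (f : ℤ[X]) (n : ℤ) : ℝ :=
  if 1 ≤ n then (expSum f (OmegaNeg f) n + expSum f (OmegaZero f) n).re
  else -(expSum f (OmegaPos f) n).re

/-- `w^{Δ₀}`. -/
def wZero (f : ℤ[X]) (n : ℤ) : ℝ := (expSum f (OmegaZero f) n).re

lemma wMinus_sub_wPlus (f : ℤ[X]) (n : ℤ) : wMinus f n - wPlus f n = wZero f n := by
  unfold wMinus wPlus wZero
  split_ifs <;> simp

lemma eval_of_mem_Omega {f : ℤ[X]} {ω : ℂ} (h : ω ∈ Omega f) :
    ∑ k ∈ f.support, (f.coeff k : ℂ) * ω ^ k = 0 := by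
  have h1 := (mem_aroots.1 (Multiset.mem_toFinset.1 h)).2
  rw [aeval_def, eval₂_eq_sum, Polynomial.sum] at h1
  simpa using h1

lemma sum_expSum {f : ℤ[X]} {S : Finset ℂ} (hS : S ⊆ Omega f) (h0 : ∀ ω ∈ S, ω ≠ 0) (n : ℤ) :
    ∑ k ∈ f.support, (f.coeff k : ℂ) * expSum f S (n + k) = 0 := by
  have h : ∀ k : ℕ, (f.coeff k : ℂ) * expSum f S (n + k) = (f.leadingCoeff : ℂ)⁻¹ *
      ∑ ω ∈ S, residue f ω * ω ^ (n - 1) * ((f.coeff k : ℂ) * ω ^ k) := by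
    intro k
    unfold expSum
    rw [mul_left_comm, Finset.mul_sum]
    congr 1
    refine Finset.sum_congr rfl fun ω hω => ?_
    rw [show n + k - 1 = (n - 1) + (k : ℤ) by ring, zpow_add₀ (h0 ω hω), zpow_natCast]
    ring
  simp_rw [h]
  rw [← Finset.mul_sum, Finset.sum_comm]
  simp_rw [← Finset.mul_sum]
  rw [Finset.sum_eq_zero (s := S), mul_zero]
  intro ω hω
  rw [eval_of_mem_Omega (hS hω), mul_zero]

lemma wZero_mem (f : ℤ[X]) : wZero f ∈ W0 f := by
  classical
  constructor
  · refine ⟨‖(f.leadingCoeff : ℂ)⁻¹‖ * ∑ ω ∈ OmegaZero f, ‖residue f ω‖, fun n => ?_⟩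
    refine (Complex.abs_re_le_norm _).trans ?_
    unfold expSum
    rw [norm_mul]
    refine mul_le_mul_of_nonneg_left ((norm_sum_le _ _).trans ?_) (norm_nonneg _)
    refine Finset.sum_le_sum fun ω hω => ?_
    have : ‖ω‖ = 1 := (Finset.mem_filter.1 hω).2
    simp [this]
  · ext n
    have h := sum_expSum (f := f) (S := OmegaZero f) (Finset.filter_subset _ _)
      (fun ω hω h => by
        have : ‖ω‖ = 1 := (Finset.mem_filter.1 hω).2
        simp [h] at this) n
    have h2 := congrArg Complex.re h
    rw [Complex.re_sum] at h2
    simpa [polyShift_apply, wZero, Complex.mul_re] using h2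

/-! ### The map `ξ̄^*` and the cocycle `d` -/

/-- The `k`-th coordinate of `σ^{-j} w^{Δ₋}` if `j ≥ 0`, of `σ^{-j} w^{Δ₊}` if `j < 0`. -/
def kernel (f : ℤ[X]) (j k : ℤ) : ℝ := if 0 ≤ j then wMinus f (k - j) else wPlus f (k - j)

/-- `ξ̄^*(v) = ∑_{j ≥ 0} v_j σ^{-j} w^{Δ₋} + ∑_{j < 0} v_j σ^{-j} w^{Δ₊}`, coordinatewise; see
`summable_kernel` for the convergence. -/
def xiBar (f : ℤ[X]) (v : BddIntSeq) : ℤ → ℝ := fun k => ∑' j : ℤ, (v.1 j : ℝ) * kernel f j k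

lemma summable_of_norm_lt {a : ℕ → ℝ} {C : ℝ} (ha : ∀ j, |a j| ≤ C) {z : ℂ} (hz : ‖z‖ < 1)
    (c : ℂ) : Summable fun j : ℕ => (a j : ℂ) * (c * z ^ j) := by
  refine Summable.of_norm_bounded (g := fun j => C * ‖c‖ * ‖z‖ ^ j)
    ((summable_geometric_of_lt_one (norm_nonneg z) hz).mul_left _) fun j => ?_
  rw [norm_mul, norm_mul, norm_pow, Complex.norm_real, Real.norm_eq_abs, mul_assoc]
  exact mul_le_mul_of_nonneg_right (ha j) (by positivity)

lemma summable_kernel (f : ℤ[X]) (v : BddIntSeq) (k : ℤ) :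
    Summable fun j : ℤ => (v.1 j : ℝ) * kernel f j k := by
  classical
  obtain ⟨C, hC⟩ := v.2
  have hC' : ∀ j, |(v.1 j : ℝ)| ≤ C := fun j => by exact_mod_cast hC j
  refine Summable.of_nat_of_neg ?_ ?_
  · have h : Summable fun j : ℕ => ((v.1 j : ℝ) : ℂ) * expSum f (OmegaPos f) (k - j) := by
      have : ∀ j : ℕ, ((v.1 j : ℝ) : ℂ) * expSum f (OmegaPos f) (k - j) =
          ∑ ω ∈ OmegaPos f, ((v.1 j : ℝ) : ℂ) *
            (((f.leadingCoeff : ℂ)⁻¹ * residue f ω * ω ^ (k - 1)) * (ω⁻¹) ^ j) := by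
        intro j
        unfold expSum
        rw [Finset.mul_sum, Finset.mul_sum]
        refine Finset.sum_congr rfl fun ω hω => ?_
        have h0 : ω ≠ 0 := by
          rintro rfl
          have := (Finset.mem_filter.1 hω).2
          simp at this
          linarith
        rw [show k - (j : ℤ) - 1 = (k - 1) + -(j : ℤ) by ring, zpow_add₀ h0, zpow_neg,
          zpow_natCast, inv_pow]
        ring
      simp_rw [this]
      refine summable_sum fun ω hω => summable_of_norm_lt (fun j => hC' _) ?_ _
      rw [norm_inv]
      exact inv_lt_one_of_one_lt₀ (Finset.mem_filter.1 hω).2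
    have h2 := ((Complex.reCLM.summable h).neg)
    refine h2.congr_atTop ?_
    filter_upwards [Filter.eventually_ge_atTop k.toNat] with j hj
    have h1 : ¬ 1 ≤ k - (j : ℤ) := by lia
    simp only [kernel, wMinus, Int.natCast_nonneg, if_true, if_neg h1, Complex.reCLM_apply,
      Complex.re_ofReal_mul]
    ring
  · set N : ℕ := k.natAbs + 1 with hN
    have h : Summable fun j : ℕ =>
        ((v.1 (-((j + N : ℕ) : ℤ)) : ℝ) : ℂ) * expSum f (OmegaNeg f) (k + (j + N : ℕ)) := by
      have : ∀ j : ℕ,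
          ((v.1 (-((j + N : ℕ) : ℤ)) : ℝ) : ℂ) * expSum f (OmegaNeg f) (k + (j + N : ℕ)) =
          ∑ ω ∈ OmegaNeg f, ((v.1 (-((j + N : ℕ) : ℤ)) : ℝ) : ℂ) *
            (((f.leadingCoeff : ℂ)⁻¹ * residue f ω * ω ^ (k + k.natAbs).toNat) * ω ^ j) := by
        intro j
        unfold expSum
        rw [Finset.mul_sum, Finset.mul_sum]
        refine Finset.sum_congr rfl fun ω hω => ?_
        rw [show k + ((j + N : ℕ) : ℤ) - 1 = (((k + k.natAbs).toNat + j : ℕ) : ℤ) by lia,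
          zpow_natCast, pow_add]
        ring
      simp_rw [this]
      exact summable_sum fun ω hω => summable_of_norm_lt (fun j => hC' _)
        (Finset.mem_filter.1 hω).2 _
    rw [← summable_nat_add_iff N]
    refine (Complex.reCLM.summable h).congr fun j => ?_
    by_cases hj : (0 : ℤ) ≤ -((j + N : ℕ) : ℤ)
    · lia
    have h1 : 1 ≤ k + ((j + N : ℕ) : ℤ) := by lia
    simp only [kernel, wPlus, if_neg hj, sub_neg_eq_add, if_pos h1, Complex.reCLM_apply,
      Complex.re_ofReal_mul]

/-- The sequence `σⁿ ξ̄^*(v) - ξ̄^*(σⁿ v)`. -/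
def dSeq (f : ℤ[X]) (n : ℤ) (v : BddIntSeq) : ℤ → ℝ :=
  shift n (xiBar f v) - xiBar f (shiftInt n v)

lemma dSeq_mem (f : ℤ[X]) (n : ℤ) (v : BddIntSeq) : dSeq f n v ∈ W0 f := by
  classical
  have key : dSeq f n v = ∑ j ∈ Finset.Ico (min 0 n) (max 0 n),
      ((if 0 ≤ j then 1 else -1) * (v.1 j : ℝ)) • shift (n - j) (wZero f) := by
    ext k
    have h1 : xiBar f (shiftInt n v) k = ∑' j : ℤ, (v.1 j : ℝ) * kernel f (j - n) k := by
      rw [← (Equiv.addRight n).tsum_eq]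
      simp [xiBar, shiftInt, shift]
    have h2 : Summable fun j : ℤ => (v.1 j : ℝ) * kernel f (j - n) k := by
      rw [← (Equiv.addRight n).summable_iff]
      simpa [Function.comp_def, shiftInt, shift] using summable_kernel f (shiftInt n v) k
    have h3 : dSeq f n v k = ∑' j : ℤ, ((v.1 j : ℝ) * kernel f j (k + n)
        - (v.1 j : ℝ) * kernel f (j - n) k) := by
      rw [(summable_kernel f v (k + n)).tsum_sub h2, ← h1]
      rfl
    rw [h3, tsum_eq_sum (s := Finset.Ico (min 0 n) (max 0 n)), Finset.sum_apply]
    · refine Finset.sum_congr rfl fun j hj => ?_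
      have hd := wMinus_sub_wPlus f (k + n - j)
      rw [Finset.mem_Ico] at hj
      simp only [kernel, Pi.smul_apply, shift, smul_eq_mul, ← hd,
        show k - (j - n) = k + n - j by ring, show k + (n - j) = k + n - j by ring]
      by_cases h0 : 0 ≤ j
      · have : ¬ 0 ≤ j - n := by lia
        simp only [if_pos h0, if_neg this]
        ring
      · have : 0 ≤ j - n := by lia
        simp only [if_neg h0, if_pos this]
        ring
    · intro j hj
      rw [Finset.mem_Ico] at hj
      have : (0 ≤ j) ↔ (0 ≤ j - n) := by lia
      simp only [kernel, this, show k - (j - n) = k + n - j by ring, sub_self]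
  rw [key]
  exact Submodule.sum_mem _ fun j _ => Submodule.smul_mem _ _ (shift_mem_W0 _ (wZero_mem f))

/-- The cocycle `d : ℤ × ℓ^∞(ℤ, ℤ) → W_f^{(0)}`, `d(n, v) = σⁿ ξ̄^*(v) - ξ̄^*(σⁿ v)`. -/
def cocycle (f : ℤ[X]) (n : ℤ) (v : BddIntSeq) : W0 f := ⟨dSeq f n v, dSeq_mem f n v⟩

/-- The space `Ỹ = ℓ^∞(ℤ, ℤ) × W_f^{(0)}`. -/
abbrev YTilde (f : ℤ[X]) : Type := BddIntSeq × W0 f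

/-- The map `σ̃(v, w) = (σ v, σ w + d(1, v))` of `Ỹ`. -/
def sigmaTilde (f : ℤ[X]) (y : YTilde f) : YTilde f :=
  (shiftInt 1 y.1, shiftW0 f y.2 + cocycle f 1 y.1)

/-! ### The map `ξ^*` takes values in `X` -/

lemma IsNormalizedIrreducible.irreducible_int {f : ℤ[X]} (hf : IsNormalizedIrreducible f) :
    Irreducible f := by
  have aux : ∀ g h : ℤ[X], f = g * h → IsUnit (toLaurent g) → IsUnit g := by
    intro g h hgh hu
    obtain ⟨q, hq⟩ := hu.exists_right_inv
    obtain ⟨n, q', hq'⟩ := LaurentPolynomial.exists_T_pow q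
    have h1 : g * q' = X ^ n := by
      apply toLaurent_injective
      rw [map_mul, hq', ← mul_assoc, hq, one_mul, toLaurent_X_pow]
    obtain ⟨i, -, hi⟩ := (dvd_prime_pow prime_X n).1 ⟨q', h1.symm⟩
    rcases Nat.eq_zero_or_pos i with rfl | hi0
    · simpa using hi.symm.isUnit isUnit_one
    · exfalso
      apply hf.coeff_zero_ne_zero
      rw [← X_dvd_iff, hgh]
      exact ((dvd_pow_self _ hi0.ne').trans hi.symm.dvd).mul_right _
  refine ⟨fun h => hf.irreducible.not_isUnit (h.map _), fun g h hgh => ?_⟩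
  rcases hf.irreducible.isUnit_or_isUnit (by rw [hgh, map_mul]) with h1 | h1
  · exact Or.inl (aux g h hgh h1)
  · exact Or.inr (aux h g (by rw [hgh, mul_comm]) h1)

lemma nodup_aroots {f : ℤ[X]} (hf : IsNormalizedIrreducible f) : (f.aroots ℂ).Nodup := by
  have hi := hf.irreducible_int
  have h1 := (IsPrimitive.Int.irreducible_iff_irreducible_map_cast
    (hi.isPrimitive hf.natDegree_pos.ne')).1 hi
  have h2 := (h1.separable.map (f := algebraMap ℚ ℂ))
  rw [Polynomial.map_map] at h2
  have h3 : (algebraMap ℚ ℂ).comp (Int.castRingHom ℚ) = algebraMap ℤ ℂ := RingHom.ext_int _ _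
  rw [h3] at h2
  exact nodup_roots h2

lemma card_aroots (f : ℤ[X]) : (f.aroots ℂ).card = f.natDegree :=
  IsAlgClosed.card_roots_map_eq_natDegree_of_injective _ (algebraMap ℤ ℂ).injective_int

lemma card_Omega {f : ℤ[X]} (hf : IsNormalizedIrreducible f) :
    (Omega f).card = f.natDegree := by
  rw [Omega, Multiset.toFinset_card_of_nodup (nodup_aroots hf), card_aroots]

lemma zero_notMem_Omega {f : ℤ[X]} (hf : IsNormalizedIrreducible f) : (0 : ℂ) ∉ Omega f := by
  intro h
  have h1 := (mem_aroots.1 (Multiset.mem_toFinset.1 h)).2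
  rw [← coeff_zero_eq_aeval_zero'] at h1
  exact hf.coeff_zero_ne_zero (by simpa using h1)

lemma partialFraction {f : ℤ[X]} (hf : IsNormalizedIrreducible f) {z : ℂ} (hz : z ∉ Omega f) :
    (aeval z f)⁻¹ = (f.leadingCoeff : ℂ)⁻¹ * ∑ ω ∈ Omega f, residue f ω / (z - ω) := by
  classical
  have hinj : Function.Injective (algebraMap ℤ ℂ) := (algebraMap ℤ ℂ).injective_int
  have h1 := C_leadingCoeff_mul_prod_multiset_X_sub_C (p := f.map (algebraMap ℤ ℂ))
    IsAlgClosed.card_roots_eq_natDegree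
  rw [leadingCoeff_map_of_injective hinj] at h1
  have h2 : ((f.map (algebraMap ℤ ℂ)).roots.map fun a => X - C a).prod =
      Lagrange.nodal (Omega f) id := by
    rw [Lagrange.nodal, Omega, Finset.prod_eq_multiset_prod, Multiset.toFinset_val,
      (nodup_aroots hf).dedup]
    rfl
  have h3 : aeval z f = (f.leadingCoeff : ℂ) * (Lagrange.nodal (Omega f) id).eval z := by
    rw [← h2, aeval_def, ← eval_map, ← h1, eval_mul, eval_C, h1]
    rfl
  have hne : (Omega f).Nonempty := by
    rw [← Finset.card_pos, card_Omega hf]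
    exact hf.natDegree_pos
  have h4 := Lagrange.eval_interpolate_not_at_node (s := Omega f) (v := id) (x := z) 1
    (fun ω hω h => hz (h ▸ hω))
  rw [Lagrange.interpolate_one (Set.injOn_id _) hne, eval_one] at h4
  rw [h3, mul_inv, inv_eq_of_mul_eq_one_right h4.symm]
  congr 1
  refine Finset.sum_congr rfl fun ω _ => ?_
  simp only [Lagrange.nodalWeight, residue, Pi.one_apply, mul_one, id, div_eq_mul_inv]

lemma sum_residue {f : ℤ[X]} (hf : IsNormalizedIrreducible f) {P : ℂ[X]}
    (hP : P.degree < f.natDegree) :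
    ∑ ω ∈ Omega f, residue f ω * P.eval ω = P.coeff (f.natDegree - 1) := by
  classical
  have h := Lagrange.coeff_eq_sum (s := Omega f) (v := id) (Set.injOn_id _) (P := P)
    (by rwa [card_Omega hf])
  rw [card_Omega hf] at h
  rw [h]
  refine Finset.sum_congr rfl fun ω _ => ?_
  rw [residue, Finset.prod_inv_distrib, mul_comm, div_eq_mul_inv]
  simp only [id]

lemma polyShift_wMinus {f : ℤ[X]} (hf : IsNormalizedIrreducible f) (n : ℤ) :
    polyShift f (wMinus f) n = if n = 0 then 1 else 0 := by
  classical
  have hlc : (f.leadingCoeff : ℂ) ≠ 0 := by exact_mod_cast hf.leadingCoeff_pos.ne'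
  have hsplit : ∀ n, wMinus f n =
      ((if 1 ≤ n then expSum f (Omega f) n else 0) - expSum f (OmegaPos f) n).re := by
    intro n
    have hsum : expSum f (Omega f) n =
        expSum f (OmegaNeg f) n + expSum f (OmegaZero f) n + expSum f (OmegaPos f) n := by
      unfold expSum OmegaNeg OmegaZero OmegaPos
      rw [← mul_add, ← mul_add, Finset.sum_filter, Finset.sum_filter, Finset.sum_filter,
        ← Finset.sum_add_distrib, ← Finset.sum_add_distrib]
      congr 1
      refine Finset.sum_congr rfl fun ω _ => ?_
      rcases lt_trichotomy ‖ω‖ 1 with h | h | h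
      · simp [h, h.ne, h.le.not_gt]
      · simp [h]
      · simp [h, h.ne', h.le.not_gt]
    unfold wMinus
    split_ifs with h
    · rw [hsum, add_sub_cancel_right]
    · simp
  have hpos := sum_expSum (f := f) (S := OmegaPos f) (Finset.filter_subset _ _)
    (fun ω hω h0 => zero_notMem_Omega hf (h0 ▸ (Finset.filter_subset _ _ hω))) n
  have hu : ∑ k ∈ f.support, (f.coeff k : ℂ) *
      (if 1 ≤ n + k then expSum f (Omega f) (n + k) else 0) = if n = 0 then 1 else 0 := by
    by_cases hn : 1 ≤ n
    · rw [if_neg (by lia), ← sum_expSum (f := f) (S := Omega f) subset_rfl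
        (fun ω hω h0 => zero_notMem_Omega hf (h0 ▸ hω)) n]
      exact Finset.sum_congr rfl fun k _ => by rw [if_pos (by lia)]
    · obtain ⟨N, rfl⟩ : ∃ N : ℕ, n = -N := ⟨n.natAbs, by lia⟩
      set P : ℂ[X] := ∑ k ∈ f.support with N + 1 ≤ k,
        Polynomial.monomial (k - (N + 1)) (f.coeff k : ℂ) with hPdef
      have hcoeff : ∀ i, P.coeff i = (f.coeff (i + (N + 1)) : ℂ) := by
        intro i
        simp only [hPdef, finsetSum_coeff, coeff_monomial]
        rw [Finset.sum_eq_single (i + (N + 1))]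
        · simp
        · intro k hk hne
          rw [Finset.mem_filter] at hk
          exact if_neg (by lia)
        · intro hk
          simp only [Finset.mem_filter, mem_support_iff, not_and, not_le] at hk
          have : f.coeff (i + (N + 1)) = 0 := by
            by_contra h
            have := hk h
            lia
          simp [this]
      have hdeg : P.degree < f.natDegree := by
        rw [degree_lt_iff_coeff_zero]
        intro i hi
        rw [hcoeff, coeff_eq_zero_of_natDegree_lt (by lia), Int.cast_zero]
      have hL := sum_residue hf hdeg
      rw [hcoeff] at hL
      have hm := hf.natDegree_pos
      have hval : ∑ k ∈ f.support, (f.coeff k : ℂ) *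
          (if 1 ≤ -(N : ℤ) + k then expSum f (Omega f) (-(N : ℤ) + k) else 0) =
          (f.leadingCoeff : ℂ)⁻¹ * ∑ ω ∈ Omega f, residue f ω * P.eval ω := by
        simp only [hPdef, eval_finsetSum, eval_monomial, Finset.mul_sum]
        rw [Finset.sum_comm' (t' := f.support.filter (N + 1 ≤ ·)) (s' := fun _ => Omega f)
          (by intros; tauto), Finset.sum_filter]
        refine Finset.sum_congr rfl fun k _ => ?_
        by_cases hk : N + 1 ≤ k
        · rw [if_pos (by lia), if_pos hk, expSum, mul_left_comm, Finset.mul_sum, Finset.mul_sum]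
          refine Finset.sum_congr rfl fun ω _ => ?_
          rw [show -(N : ℤ) + k - 1 = ((k - (N + 1) : ℕ) : ℤ) by lia, zpow_natCast]
          ring
        · rw [if_neg (by lia), if_neg hk, mul_zero]
      rw [hval, hL]
      by_cases hN : N = 0
      · subst hN
        rw [zero_add, Nat.sub_add_cancel hm, coeff_natDegree, inv_mul_cancel₀ hlc]
        simp
      · rw [coeff_eq_zero_of_natDegree_lt (by lia)]
        simp [hN]
  have h := congrArg Complex.re (congrArg₂ (· - ·) hu hpos)
  simp only [← Finset.sum_sub_distrib, ← mul_sub, sub_zero] at h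
  rw [Complex.re_sum] at h
  have hre : (if n = 0 then (1 : ℂ) else 0).re = if n = 0 then 1 else 0 := by
    split_ifs <;> simp
  rw [hre] at h
  rw [← h, polyShift_apply]
  refine Finset.sum_congr rfl fun k _ => ?_
  rw [hsplit, zsmul_eq_mul, ← Complex.ofReal_intCast, Complex.re_ofReal_mul]

lemma polyShift_wPlus {f : ℤ[X]} (hf : IsNormalizedIrreducible f) (n : ℤ) :
    polyShift f (wPlus f) n = if n = 0 then 1 else 0 := by
  have h : wPlus f = wMinus f - wZero f := by
    ext n
    rw [Pi.sub_apply, ← wMinus_sub_wPlus]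
    ring
  rw [h, map_sub, (wZero_mem f).2, sub_zero, polyShift_wMinus hf]

lemma polyShift_xiBar {f : ℤ[X]} (hf : IsNormalizedIrreducible f) (v : BddIntSeq) :
    polyShift f (xiBar f v) = fun n => (v.1 n : ℝ) := by
  ext n
  have h1 : polyShift f (xiBar f v) n = ∑' j : ℤ, ∑ k ∈ f.support,
      f.coeff k • ((v.1 j : ℝ) * kernel f j (n + k)) := by
    rw [Summable.tsum_finsetSum fun (k : ℕ) _ =>
      (summable_kernel f v (n + k)).const_smul (f.coeff k)]
    rw [polyShift_apply]
    refine Finset.sum_congr rfl fun k _ => ?_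
    simp only [zsmul_eq_mul, xiBar, tsum_mul_left]
  have h2 : ∀ j : ℤ, ∑ k ∈ f.support, f.coeff k • ((v.1 j : ℝ) * kernel f j (n + k)) =
      (v.1 j : ℝ) * if n = j then 1 else 0 := by
    intro j
    rw [Finset.sum_congr rfl fun (k : ℕ) _ =>
      (mul_smul_comm (f.coeff k) (v.1 j : ℝ) (kernel f j (n + k))).symm, ← Finset.mul_sum]
    congr 1
    unfold kernel
    by_cases hj : 0 ≤ j
    · have := polyShift_wMinus hf (n - j)
      simp only [if_pos hj, ← sub_eq_zero (a := n) (b := j), ← this, polyShift_apply]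
      exact Finset.sum_congr rfl fun k _ => by rw [add_sub_right_comm]
    · have := polyShift_wPlus hf (n - j)
      simp only [if_neg hj, ← sub_eq_zero (a := n) (b := j), ← this, polyShift_apply]
      exact Finset.sum_congr rfl fun k _ => by rw [add_sub_right_comm]
  rw [h1]
  simp_rw [h2]
  rw [tsum_eq_single n]
  · simp
  · intro j hj
    simp [hj.symm]

/-- `ξ^* = ρ^* ∘ ξ̄^* : ℓ^∞(ℤ, ℤ) → X`. -/
def xiStar {f : ℤ[X]} (hf : IsNormalizedIrreducible f) (v : BddIntSeq) : XGroup f :=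
  ⟨rho (xiBar f v), by
    change polyShift f (rho (xiBar f v)) = 0
    rw [polyShift_rho, polyShift_xiBar hf]
    ext n
    exact (AddCircle.coe_eq_zero_iff 1).2 ⟨v.1 n, by simp⟩⟩

/-- `ξ^*_b(v) = ξ^*(v) + ρ^*(b(v))` for a map `b : ℓ^∞(ℤ, ℤ) → W_f^{(0)}`. -/
def xiStarB {f : ℤ[X]} (hf : IsNormalizedIrreducible f) (b : BddIntSeq → W0 f)
    (v : BddIntSeq) : XGroup f := xiStar hf v + rhoW0 f (b v)

end NonexpansiveCoding

end

open NonexpansiveCoding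

open Filter ProbabilityTheory
open scoped Topology

namespace NonexpansiveCoding

/-! ### Measurability and continuity -/

/-! The shift acts on `W0 f` by isometries of the supremum norm. Sup-norm balls around 0 are compact
for coordinatewise convergence, and countably many of them cover `W0 f`. The equivalence is proved
as the cycle 1 → 3 → 2 → 1.

(1 → 3) Disintegrate an invariant measure over `ν` into probability measures on the fibres `W0 f`.
Uniqueness of the disintegration shows that the isometry `w ↦ σ w + d(1, v)` carries the fibre
measure at `v` to the one at `σ v`, almost everywhere. A measurable choice of center for each
probability measure, equivariant under these isometries (`center_map_affineShift`), gives `b`. The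
mean of the fibre measure would be equivariant but need not exist, so the average is taken over a
bounded set determined by the measure.

(3 → 2) Iterating gives `d(k, v) = b(σᵏ v) - σᵏ b(v)` (`ae_cocycle_eq`). Both terms lie in a fixed
ball with high probability, uniformly in `k`, because `ν` is invariant and the ball is
shift-invariant.

(2 → 1) The iterates of the product of `ν` with the point mass at 0 under the skew product are the
laws of `(σⁿ v, d(n, v))` (`sigmaTilde_iterate`). They are tight and project to `ν`, so the
Krylov–Bogoliubov argument applies.

The final claims follow since the coboundary equation says that `xiBar f v + b v` is
shift-equivariant. -/

instance : SecondCountableTopology BddIntSeq :=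
  Topology.IsEmbedding.subtypeVal.secondCountableTopology

instance : TopologicalSpace.MetrizableSpace BddIntSeq :=
  inferInstanceAs (TopologicalSpace.MetrizableSpace {v : ℤ → ℤ // v ∈ BddIntSeq})

instance (f : ℤ[X]) : SecondCountableTopology (W0 f) :=
  Topology.IsEmbedding.subtypeVal.secondCountableTopology

instance (f : ℤ[X]) : TopologicalSpace.MetrizableSpace (W0 f) :=
  inferInstanceAs (TopologicalSpace.MetrizableSpace {w : ℤ → ℝ // w ∈ W0 f})

lemma continuous_polyShift {A : Type*} [AddCommGroup A] [TopologicalSpace A] [ContinuousAdd A]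
    [ContinuousConstSMul ℤ A] (f : ℤ[X]) : Continuous (polyShift (A := A) f) := by
  refine continuous_pi fun n => ?_
  simp only [polyShift_apply]
  fun_prop

lemma continuous_shiftInt (n : ℤ) : Continuous (shiftInt n) :=
  continuous_induced_rng.2 (continuous_pi fun k =>
    (continuous_apply (k + n)).comp continuous_subtype_val)

lemma continuous_shiftW0 (f : ℤ[X]) : Continuous (shiftW0 f) :=
  continuous_induced_rng.2 (continuous_pi fun k =>
    (continuous_apply (k + 1)).comp continuous_subtype_val)

/-- Shifting `v` by one moves only the index `j = 0` across the boundary between the two kernels, so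
a single term survives. Thus `cocycle f 1` depends continuously on `v 0` alone, whereas `xiBar` is
only treated as a measurable map. -/
lemma cocycle_one (f : ℤ[X]) (v : BddIntSeq) :
    cocycle f 1 v = (v.1 0 : ℝ) • ⟨shift 1 (wZero f), shift_mem_W0 1 (wZero_mem f)⟩ := by
  refine Subtype.ext (funext fun k => ?_)
  have h1 : xiBar f (shiftInt 1 v) k = ∑' j : ℤ, (v.1 j : ℝ) * kernel f (j - 1) k := by
    rw [← (Equiv.addRight (1 : ℤ)).tsum_eq]
    simp [xiBar, shiftInt, shift]
  have h2 : Summable fun j : ℤ => (v.1 j : ℝ) * kernel f (j - 1) k := by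
    rw [← (Equiv.addRight (1 : ℤ)).summable_iff]
    simpa [Function.comp_def, shiftInt, shift] using summable_kernel f (shiftInt 1 v) k
  have h3 : (cocycle f 1 v).1 k = ∑' j : ℤ, ((v.1 j : ℝ) * kernel f j (k + 1)
      - (v.1 j : ℝ) * kernel f (j - 1) k) := by
    rw [(summable_kernel f v (k + 1)).tsum_sub h2, ← h1]
    rfl
  rw [h3, tsum_eq_single 0]
  · simp only [kernel, le_refl, if_true, sub_zero, zero_sub, sub_neg_eq_add,
      show ¬ (0 : ℤ) ≤ -1 by lia, if_false, ← mul_sub, wMinus_sub_wPlus]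
    rfl
  · intro j hj
    have : (0 ≤ j) ↔ (0 ≤ j - 1) := by lia
    simp only [kernel, this, show k - (j - 1) = k + 1 - j by ring, sub_self]

lemma continuous_cocycle_one (f : ℤ[X]) : Continuous (cocycle f 1) := by
  have h : Continuous fun v : BddIntSeq => (v.1 0 : ℝ) :=
    continuous_of_discreteTopology.comp ((continuous_apply 0).comp continuous_subtype_val)
  rw [funext (cocycle_one f)]
  exact h.smul continuous_const

lemma continuous_sigmaTilde (f : ℤ[X]) : Continuous (sigmaTilde f) :=
  ((continuous_shiftInt 1).comp continuous_fst).prodMk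
    (((continuous_shiftW0 f).comp continuous_snd).add
      ((continuous_cocycle_one f).comp continuous_fst))

lemma measurable_xiBar (f : ℤ[X]) : Measurable (xiBar f) := by
  refine measurable_pi_iff.2 fun k => ?_
  refine measurable_of_tendsto_metrizable'
    (f := fun (s : Finset ℤ) (v : BddIntSeq) => ∑ j ∈ s, (v.1 j : ℝ) * kernel f j k) atTop
    (fun s => ?_) (tendsto_pi_nhds.2 fun v => (summable_kernel f v k).hasSum)
  refine Finset.measurable_sum _ fun j _ => Measurable.mul_const ?_ _
  exact (measurable_from_top (f := fun z : ℤ => (z : ℝ))).comp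
    ((measurable_pi_apply j).comp measurable_subtype_coe)

lemma measurable_cocycle (f : ℤ[X]) (n : ℤ) : Measurable (cocycle f n) := by
  refine Measurable.subtype_mk (measurable_pi_iff.2 fun k => ?_)
  exact ((measurable_pi_apply (k + n)).comp (measurable_xiBar f)).sub
    ((measurable_pi_apply k).comp ((measurable_xiBar f).comp (continuous_shiftInt n).measurable))

/-! ### Balls -/

/-- The closed ball of radius `R` around `w` in `W_f^{(0)}`, with respect to the supremum norm. -/
def supBall (f : ℤ[X]) (R : ℝ) (w : W0 f) : Set (W0 f) := {u | ∀ n, |u.1 n - w.1 n| ≤ R}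

lemma isClosed_supBall (f : ℤ[X]) (R : ℝ) (w : W0 f) : IsClosed (supBall f R w) := by
  simp only [supBall, Set.ofPred_forall]
  refine isClosed_iInter fun n => isClosed_le ?_ continuous_const
  exact (((continuous_apply n).comp continuous_subtype_val).sub continuous_const).abs

/-- By Tychonoff: inside `ℝ^ℤ` the ball is a product of compact intervals cut by the closed kernel
of `polyShift f`. -/
lemma isCompact_supBall_zero (f : ℤ[X]) (R : ℝ) : IsCompact (supBall f R 0) := by
  rw [Subtype.isCompact_iff]
  have h : ((↑) : W0 f → ℤ → ℝ) '' supBall f R 0 =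
      (Set.univ.pi fun _ => Set.Icc (-R) R) ∩ polyShift f ⁻¹' {0} := by
    ext w
    simp only [Set.mem_image, supBall, Set.mem_inter_iff, Set.mem_pi, Set.mem_preimage,
      Set.mem_singleton_iff, Set.mem_univ, true_imp_iff, Set.mem_Icc, ← abs_le]
    constructor
    · rintro ⟨u, hu, rfl⟩
      exact ⟨fun n => by simpa using hu n, u.2.2⟩
    · rintro ⟨hb, hp⟩
      exact ⟨⟨w, ⟨R, hb⟩, hp⟩, fun n => by simpa using hb n, rfl⟩
  rw [h]
  exact (isCompact_univ_pi fun _ => isCompact_Icc).inter_right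
    (isClosed_singleton.preimage (continuous_polyShift f))

lemma exists_mem_supBall_zero {f : ℤ[X]} (w : W0 f) : ∃ m : ℕ, w ∈ supBall f m 0 := by
  obtain ⟨C, hC⟩ := w.2.1
  obtain ⟨m, hm⟩ := exists_nat_ge C
  exact ⟨m, fun n => by simpa using (hC n).trans hm⟩

lemma supBall_mono (f : ℤ[X]) {R S : ℝ} (h : R ≤ S) (w : W0 f) :
    supBall f R w ⊆ supBall f S w := fun _ hu n => (hu n).trans h

/-- The set of integer sequences bounded by `m`. -/
def intBall (m : ℕ) : Set BddIntSeq := {v | ∀ n, |v.1 n| ≤ m}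

lemma isCompact_intBall (m : ℕ) : IsCompact (intBall m) := by
  rw [Subtype.isCompact_iff]
  have h : ((↑) : BddIntSeq → ℤ → ℤ) '' intBall m =
      Set.univ.pi fun _ => Set.Icc (-(m : ℤ)) m := by
    ext w
    simp only [Set.mem_image, intBall, Set.mem_pi, Set.mem_univ, true_imp_iff,
      Set.mem_Icc, ← abs_le]
    constructor
    · rintro ⟨u, hu, rfl⟩
      exact hu
    · intro hb
      exact ⟨⟨w, m, hb⟩, hb, rfl⟩
  rw [h]
  exact isCompact_univ_pi fun _ => (Set.finite_Icc _ _).isCompact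

lemma exists_mem_intBall (v : BddIntSeq) : ∃ m : ℕ, v ∈ intBall m := by
  obtain ⟨C, hC⟩ := v.2
  exact ⟨C.toNat, fun n => (hC n).trans (Int.self_le_toNat C)⟩

/-- Needed for conditional kernels with values in `W0 f`. Boundedness is a countable union of closed
conditions, so `W0 f` is Borel in `ℝ^ℤ`. -/
instance (f : ℤ[X]) : StandardBorelSpace (W0 f) := by
  have h : MeasurableSet (W0 f : Set (ℤ → ℝ)) := by
    have : (W0 f : Set (ℤ → ℝ)) = (⋃ m : ℕ, Set.univ.pi fun _ => Set.Icc (-(m : ℝ)) m) ∩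
        polyShift f ⁻¹' {0} := by
      ext w
      simp only [Set.mem_inter_iff, Set.mem_iUnion, Set.mem_pi, Set.mem_univ, true_imp_iff,
        Set.mem_Icc, ← abs_le, Set.mem_preimage, Set.mem_singleton_iff]
      refine ⟨fun hw => ⟨?_, hw.2⟩, fun hw => ⟨?_, hw.2⟩⟩
      · obtain ⟨C, hC⟩ := hw.1
        obtain ⟨m, hm⟩ := exists_nat_ge C
        exact ⟨m, fun n => (hC n).trans hm⟩
      · obtain ⟨m, hm⟩ := hw.1
        exact ⟨m, hm⟩
    rw [this]
    refine (MeasurableSet.iUnion fun m => ?_).inter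
      (isClosed_singleton.preimage (continuous_polyShift f)).measurableSet
    exact (isClosed_set_pi fun _ _ => isClosed_Icc).measurableSet
  exact h.standardBorel

lemma exists_measure_compl_lt {α : Type*} [MeasurableSpace α] (μ : Measure α) [IsFiniteMeasure μ]
    {s : ℕ → Set α} (hs : ∀ m, MeasurableSet (s m)) (hmono : Monotone s)
    (hU : ∀ x, ∃ m, x ∈ s m) {ε : ENNReal} (hε : 0 < ε) : ∃ m, μ (s m)ᶜ < ε := by
  have h := tendsto_measure_iInter_atTop (μ := μ) (s := fun m => (s m)ᶜ)
    (fun m => (hs m).compl.nullMeasurableSet)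
    (fun i j hij => Set.compl_subset_compl.2 (hmono hij)) ⟨0, measure_ne_top _ _⟩
  have h0 : ⋂ m, (s m)ᶜ = ∅ := by
    rw [← Set.compl_iUnion, Set.compl_empty_iff]
    exact Set.eq_univ_of_forall fun x => Set.mem_iUnion.2 (hU x)
  rw [h0, measure_empty] at h
  exact (h.eventually_lt_const hε).exists

/-! ### Invariant measures from tight orbits -/

/-- Krylov–Bogoliubov: a limit of Cesàro averages of the orbit of `μ` is invariant. Tightness and
Prokhorov's theorem replace compactness of `E`. -/
lemma exists_invariant_of_isTightMeasureSet {E F : Type*} [MeasurableSpace E] [TopologicalSpace E]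
    [TopologicalSpace.MetrizableSpace E] [BorelSpace E]
    [MeasurableSpace F] [TopologicalSpace F] [TopologicalSpace.MetrizableSpace F] [BorelSpace F]
    {T : E → E} (hT : Continuous T) {p : E → F} (hp : Continuous p)
    (μ : Measure E) [IsProbabilityMeasure μ] (ν : Measure F)
    (htight : IsTightMeasureSet (Set.range fun n : ℕ => μ.map T^[n]))
    (hν : ∀ n : ℕ, (μ.map T^[n]).map p = ν) :
    ∃ η : Measure E, IsProbabilityMeasure η ∧ MeasurePreserving T η η ∧ η.map p = ν := by
  have hTn : ∀ n, Measurable T^[n] := fun n => (hT.iterate n).measurable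
  have hprob : ∀ n, IsProbabilityMeasure (μ.map T^[n]) := fun n =>
    Measure.isProbabilityMeasure_map (hTn n).aemeasurable
  let M : ℕ → Measure E := fun N =>
    ((N + 1 : ℕ) : ENNReal)⁻¹ • ∑ n ∈ Finset.range (N + 1), μ.map T^[n]
  have hcancel : ∀ N : ℕ, ((N + 1 : ℕ) : ENNReal)⁻¹ * ((N + 1 : ℕ) : ENNReal) = 1 := fun N =>
    ENNReal.inv_mul_cancel (by simp) (ENNReal.natCast_ne_top _)
  have hMapply : ∀ N s, M N s =
      ((N + 1 : ℕ) : ENNReal)⁻¹ * ∑ n ∈ Finset.range (N + 1), μ.map T^[n] s := by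
    intro N s
    simp [M]
  have hM : ∀ N, IsProbabilityMeasure (M N) := fun N => ⟨by
    rw [hMapply]
    simp only [measure_univ, Finset.sum_const, Finset.card_range, nsmul_eq_mul, mul_one]
    exact hcancel N⟩
  let P : ℕ → ProbabilityMeasure E := fun N => ⟨M N, hM N⟩
  have hPtight : IsTightMeasureSet {((η : ProbabilityMeasure E) : Measure E) | η ∈ Set.range P} := by
    rw [isTightMeasureSet_iff_exists_isCompact_measure_compl_le] at htight ⊢
    intro ε hε
    obtain ⟨K, hK, h⟩ := htight ε hε
    refine ⟨K, hK, ?_⟩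
    rintro _ ⟨_, ⟨N, rfl⟩, rfl⟩
    change M N Kᶜ ≤ ε
    rw [hMapply]
    calc ((N + 1 : ℕ) : ENNReal)⁻¹ * ∑ n ∈ Finset.range (N + 1), μ.map T^[n] Kᶜ
        ≤ ((N + 1 : ℕ) : ENNReal)⁻¹ * ∑ n ∈ Finset.range (N + 1), ε := by
          gcongr with n _
          exact h _ ⟨n, rfl⟩
      _ = ε := by
          rw [Finset.sum_const, Finset.card_range, nsmul_eq_mul, ← mul_assoc, hcancel, one_mul]
  have hcomp := isCompact_closure_of_isTightMeasureSet hPtight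
  -- A limit along a free ultrafilter avoids extracting a subsequence.
  obtain ⟨η, -, hη⟩ := isCompact_iff_ultrafilter_le_nhds.1 hcomp ((hyperfilter ℕ).map P)
    (by
      rw [Ultrafilter.coe_map, le_principal_iff, mem_map]
      exact univ_mem' fun N => subset_closure ⟨N, rfl⟩)
  have hlim : Tendsto P (hyperfilter ℕ) (𝓝 η) := hη
  have hint : ∀ (g : BoundedContinuousFunction E ℝ) (N : ℕ), ∫ x, g x ∂(M N) =
      ((N + 1 : ℕ) : ℝ)⁻¹ * ∑ n ∈ Finset.range (N + 1), ∫ x, g (T^[n] x) ∂μ := by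
    intro g N
    rw [integral_smul_measure, integral_finsetSum_measure]
    · simp only [ENNReal.toReal_inv, ENNReal.toReal_natCast, smul_eq_mul]
      congr 1
      refine Finset.sum_congr rfl fun n _ => ?_
      exact integral_map (hTn n).aemeasurable g.continuous.aestronglyMeasurable
    · exact fun n _ => g.integrable _
  refine ⟨η, inferInstance, ⟨hT.measurable, ?_⟩, ?_⟩
  · have : IsProbabilityMeasure ((η : Measure E).map T) :=
      Measure.isProbabilityMeasure_map hT.measurable.aemeasurable
    refine ext_of_forall_integral_eq_of_IsFiniteMeasure fun g => ?_
    rw [integral_map hT.measurable.aemeasurable g.continuous.aestronglyMeasurable]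
    have h1 := (ProbabilityMeasure.tendsto_iff_forall_integral_tendsto.1 hlim) g
    have h2 := (ProbabilityMeasure.tendsto_iff_forall_integral_tendsto.1 hlim)
      (g.compContinuous ⟨T, hT⟩)
    have h3 : Tendsto (fun N : ℕ => ∫ x, (g.compContinuous ⟨T, hT⟩) x ∂(P N : Measure E) -
        ∫ x, g x ∂(P N : Measure E)) (hyperfilter ℕ) (𝓝 0) := by
      refine Tendsto.mono_left ?_ Nat.hyperfilter_le_atTop
      -- The difference of the two averages telescopes to two boundary terms, each at most `‖g‖`,
      -- divided by `N + 1`.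
      refine squeeze_zero_norm (a := fun N : ℕ => (2 * ‖g‖) * (1 / ((N : ℝ) + 1))) (fun N => ?_) ?_
      · have e : ∫ x, (g.compContinuous ⟨T, hT⟩) x ∂(M N) - ∫ x, g x ∂(M N) =
            ((N + 1 : ℕ) : ℝ)⁻¹ * (∫ x, g (T^[N + 1] x) ∂μ - ∫ x, g x ∂μ) := by
          rw [hint, hint, ← mul_sub, ← Finset.sum_sub_distrib]
          congr 1
          simp only [BoundedContinuousFunction.compContinuous_apply, ContinuousMap.coe_mk,
            ← Function.iterate_succ_apply']
          exact Finset.sum_range_sub (fun n => ∫ x, g (T^[n] x) ∂μ) (N + 1)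
        change ‖∫ x, (g.compContinuous ⟨T, hT⟩) x ∂(M N) - ∫ x, g x ∂(M N)‖ ≤ _
        rw [e, norm_mul, mul_comm, norm_inv, RCLike.norm_natCast]
        push_cast
        rw [one_div]
        gcongr
        have hb : ∀ F : E → E, ‖∫ x, g (F x) ∂μ‖ ≤ ‖g‖ := fun F => by
          refine (norm_integral_le_of_norm_le_const (C := ‖g‖)
            (ae_of_all _ fun x => g.norm_coe_le_norm _)).trans ?_
          simp
        exact (norm_sub_le _ _).trans (by linarith [hb T^[N + 1], show ‖∫ x, g x ∂μ‖ ≤ ‖g‖ from hb id])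
      · simpa using tendsto_one_div_add_atTop_nhds_zero_nat.const_mul (2 * ‖g‖)
    have h4 := tendsto_nhds_unique (h2.sub h1) h3
    exact sub_eq_zero.1 h4
  · have hmap := ProbabilityMeasure.tendsto_map_of_tendsto_of_continuous _ _ hlim hp
    have hMmap : ∀ N, (M N).map p = ν := by
      intro N
      ext s hs
      rw [Measure.map_apply hp.measurable hs, hMapply]
      have : ∀ n ∈ Finset.range (N + 1), μ.map T^[n] (p ⁻¹' s) = ν s := fun n _ => by
        rw [← Measure.map_apply hp.measurable hs, hν]
      rw [Finset.sum_congr rfl this, Finset.sum_const, Finset.card_range, nsmul_eq_mul,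
        ← mul_assoc, hcancel, one_mul]
    -- Every average projects to `ν`, so the projections form a constant sequence and their limit is
    -- `ν`.
    have hconst : ∀ N, (P N).map hp.measurable.aemeasurable =
        (P 0).map hp.measurable.aemeasurable := fun N =>
      Subtype.ext ((hMmap N).trans (hMmap 0).symm)
    simp only [hconst] at hmap
    have := tendsto_nhds_unique hmap tendsto_const_nhds
    exact (congrArg Subtype.val this).trans (hMmap 0)

/-! ### Iterates of the skew product -/

lemma shiftInt_comp (m n : ℤ) (v : BddIntSeq) :
    shiftInt m (shiftInt n v) = shiftInt (m + n) v :=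
  Subtype.ext (funext fun k => by simp [shiftInt, shift, add_assoc])

lemma shiftInt_zero (v : BddIntSeq) : shiftInt 0 v = v :=
  Subtype.ext (funext fun k => by simp [shiftInt, shift])

/-- The induction step is the cocycle identity `d(n + 1, v) = σ d(n, v) + d(1, σⁿ v)`. -/
lemma sigmaTilde_iterate (f : ℤ[X]) (n : ℕ) (v : BddIntSeq) :
    (sigmaTilde f)^[n] (v, 0) = (shiftInt n v, cocycle f n v) := by
  induction n with
  | zero =>
    refine Prod.ext (shiftInt_zero v).symm (Subtype.ext (funext fun k => ?_))
    simp [cocycle, dSeq, shift, shiftInt_zero]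
  | succ n ih =>
    rw [Function.iterate_succ_apply', ih]
    refine Prod.ext ?_ (Subtype.ext (funext fun k => ?_))
    · simp only [sigmaTilde, shiftInt_comp]
      congr 1
      push_cast
      ring
    · simp only [sigmaTilde, cocycle, shiftW0, Submodule.coe_add, Pi.add_apply, dSeq, shift,
        Pi.sub_apply, shiftInt_comp]
      rw [show k + 1 + (n : ℤ) = k + ((n + 1 : ℕ) : ℤ) by push_cast; ring,
        show 1 + (n : ℤ) = ((n + 1 : ℕ) : ℤ) by push_cast; ring]
      ring

lemma measurePreserving_shiftInt {ν : Measure BddIntSeq}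
    (hν : MeasurePreserving (shiftInt 1) ν ν) (n : ℤ) : MeasurePreserving (shiftInt n) ν ν := by
  let e : BddIntSeq ≃ᵐ BddIntSeq :=
    { toFun := shiftInt 1
      invFun := shiftInt (-1)
      left_inv := fun v => by rw [shiftInt_comp, neg_add_cancel, shiftInt_zero]
      right_inv := fun v => by rw [shiftInt_comp, add_neg_cancel, shiftInt_zero]
      measurable_toFun := (continuous_shiftInt 1).measurable
      measurable_invFun := (continuous_shiftInt (-1)).measurable }
  have hneg : MeasurePreserving (shiftInt (-1)) ν ν := MeasurePreserving.symm e hν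
  induction n with
  | zero =>
    rw [show shiftInt 0 = id from funext shiftInt_zero]
    exact MeasurePreserving.id ν
  | succ n ih =>
    rw [show shiftInt (n + 1) = shiftInt n ∘ shiftInt 1 from
      funext fun v => (shiftInt_comp _ _ _).symm]
    exact ih.comp hν
  | pred n ih =>
    rw [show shiftInt (-n - 1) = shiftInt (-n) ∘ shiftInt (-1) from
      funext fun v => (shiftInt_comp _ _ _).symm]
    exact ih.comp hneg

lemma exists_invariant_of_cocycle_tight (f : ℤ[X]) (ν : Measure BddIntSeq)
    [IsProbabilityMeasure ν] (hν : MeasurePreserving (shiftInt 1) ν ν)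
    (h : ∀ ε : ℝ, 0 < ε → ∃ C : Set (W0 f), IsCompact C ∧
      ∀ k : ℤ, 1 - ε < ν.real {v | cocycle f k v ∈ C}) :
    ∃ νt : Measure (YTilde f), IsProbabilityMeasure νt ∧
      MeasurePreserving (sigmaTilde f) νt νt ∧ νt.map Prod.fst = ν := by
  have hm0 : Measurable fun v : BddIntSeq => ((v, 0) : YTilde f) := by fun_prop
  have hmn : ∀ n : ℤ, Measurable fun v : BddIntSeq => ((shiftInt n v, cocycle f n v) : YTilde f) :=
    fun n => (continuous_shiftInt n).measurable.prodMk (measurable_cocycle f n)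
  have hprob : IsProbabilityMeasure (ν.map fun v : BddIntSeq => ((v, 0) : YTilde f)) :=
    Measure.isProbabilityMeasure_map hm0.aemeasurable
  have hmap : ∀ n : ℕ, (ν.map fun v : BddIntSeq => ((v, 0) : YTilde f)).map (sigmaTilde f)^[n] =
      ν.map fun v => (shiftInt n v, cocycle f n v) := by
    intro n
    rw [Measure.map_map ((continuous_sigmaTilde f).iterate n).measurable hm0]
    congr 1
    exact funext (sigmaTilde_iterate f n)
  refine exists_invariant_of_isTightMeasureSet (continuous_sigmaTilde f) continuous_fst
    (ν.map fun v => (v, 0)) ν ?_ fun n => ?_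
  · rw [isTightMeasureSet_iff_exists_isCompact_measure_compl_le]
    intro ε hε
    -- The tightness criterion allows `ε = ⊤`, while the hypothesis takes a real number; half of `ε`
    -- is left for the first coordinate.
    obtain ⟨δ, hδ, hδε⟩ : ∃ δ : ℝ, 0 < δ ∧ ENNReal.ofReal δ ≤ ε / 2 := by
      rcases eq_or_ne ε ⊤ with rfl | hε'
      · exact ⟨1, one_pos, by simp [ENNReal.top_div]⟩
      · refine ⟨(ε / 2).toReal, ENNReal.toReal_pos (ENNReal.half_pos hε.ne').ne' ?_, ?_⟩
        · exact (ENNReal.half_lt_self hε.ne' hε').ne_top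
        · exact ENNReal.ofReal_toReal_le
    obtain ⟨C, hC, hCν⟩ := h δ hδ
    obtain ⟨m, hm⟩ := exists_measure_compl_lt ν (s := intBall)
      (fun m => (isCompact_intBall m).isClosed.measurableSet)
      (fun i j hij v hv n => (hv n).trans (by exact_mod_cast hij))
      exists_mem_intBall (ENNReal.half_pos hε.ne')
    -- By invariance of `ν`, one `m` controls the law of `σⁿ v` for all `n`.
    refine ⟨intBall m ×ˢ C, (isCompact_intBall m).prod hC, ?_⟩
    rintro _ ⟨n, rfl⟩
    have hK : MeasurableSet (intBall m ×ˢ C)ᶜ :=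
      ((isCompact_intBall m).prod hC).isClosed.measurableSet.compl
    have hCm : MeasurableSet {v | cocycle f n v ∈ C} :=
      measurable_cocycle f n hC.isClosed.measurableSet
    simp only [hmap]
    rw [Measure.map_apply (hmn n) hK]
    have hsub : (fun v => ((shiftInt n v, cocycle f n v) : YTilde f)) ⁻¹' (intBall m ×ˢ C)ᶜ ⊆
        (shiftInt n) ⁻¹' (intBall m)ᶜ ∪ {v | cocycle f n v ∈ C}ᶜ := by
      intro v hv
      by_contra hcon
      simp only [Set.mem_union, not_or, Set.mem_preimage, Set.mem_compl_iff, not_not,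
        Set.mem_ofPred_eq] at hcon
      exact hv ⟨hcon.1, hcon.2⟩
    refine (measure_mono hsub).trans ((measure_union_le _ _).trans ?_)
    rw [(measurePreserving_shiftInt hν n).measure_preimage
      (isCompact_intBall m).isClosed.measurableSet.compl.nullMeasurableSet, ← ENNReal.add_halves ε]
    refine add_le_add hm.le (le_trans ?_ hδε)
    rw [← ofReal_measureReal, probReal_compl_eq_one_sub hCm]
    exact ENNReal.ofReal_le_ofReal (by linarith [hCν n])
  · rw [hmap, Measure.map_map measurable_fst (hmn n)]
    exact (measurePreserving_shiftInt hν n).map_eq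

/-! ### The center of a probability measure on `W_f^{(0)}` -/

/-- The set of points whose closed `R`-ball has measure more than `1 / 2`. -/
def heavySet (f : ℤ[X]) (μ : Measure (W0 f)) (R : ℕ) : Set (W0 f) :=
  {w | 2⁻¹ < μ (supBall f R w)}

lemma measurable_coord (f : ℤ[X]) (n : ℤ) : Measurable fun w : W0 f => w.1 n :=
  (measurable_pi_apply n).comp measurable_subtype_coe

lemma measurableSet_supBall_rel (f : ℤ[X]) (R : ℝ) :
    MeasurableSet {p : W0 f × W0 f | p.2 ∈ supBall f R p.1} := by
  have h : ∀ n : ℤ, Measurable fun p : W0 f × W0 f => |p.2.1 n - p.1.1 n| := fun n =>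
    (((measurable_coord f n).comp measurable_snd).sub
      ((measurable_coord f n).comp measurable_fst)).abs
  have hset : {p : W0 f × W0 f | p.2 ∈ supBall f R p.1} =
      ⋂ n : ℤ, {p : W0 f × W0 f | |p.2.1 n - p.1.1 n| ≤ R} := by
    ext p
    simp [supBall]
  rw [hset]
  exact MeasurableSet.iInter fun n => measurableSet_le (h n) measurable_const

/-- The mass of the ball around `w` under `κ a` is jointly measurable in `(a, w)`: it measures the
sections of a measurable relation. -/
lemma measurableSet_heavySet_kernel {α : Type*} [MeasurableSpace α] (f : ℤ[X])
    (κ : Kernel α (W0 f)) [IsMarkovKernel κ] (R : ℕ) :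
    MeasurableSet {p : α × W0 f | p.2 ∈ heavySet f (κ p.1) R} := by
  have h : MeasurableSet {q : (α × W0 f) × W0 f | q.2 ∈ supBall f R q.1.2} :=
    (measurable_snd.comp measurable_fst).prodMk measurable_snd (measurableSet_supBall_rel f R)
  exact measurableSet_lt measurable_const
    (Kernel.measurable_kernel_prodMk_left (κ := κ.comap Prod.fst measurable_fst) h)

lemma measurableSet_heavySet (f : ℤ[X]) (μ : Measure (W0 f)) [IsProbabilityMeasure μ] (R : ℕ) :
    MeasurableSet (heavySet f μ R) :=
  measurable_prodMk_left (x := ()) (measurableSet_heavySet_kernel f (Kernel.const Unit μ) R)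

lemma exists_heavySet_pos (f : ℤ[X]) (μ : Measure (W0 f)) [IsProbabilityMeasure μ] :
    ∃ R : ℕ, 0 < μ (heavySet f μ R) := by
  obtain ⟨m, hm⟩ := exists_measure_compl_lt μ (s := fun m : ℕ => supBall f m 0)
    (fun m => (isClosed_supBall f m 0).measurableSet)
    (fun i j hij => supBall_mono f (by exact_mod_cast hij) 0) exists_mem_supBall_zero
    (ε := 2⁻¹) (by simp)
  have hhalf : 2⁻¹ < μ (supBall f m 0) := by
    rw [prob_compl_eq_one_sub (isClosed_supBall f m 0).measurableSet] at hm
    by_contra! hle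
    have := tsub_le_tsub_left hle (1 : ENNReal)
    rw [ENNReal.one_sub_inv_two] at this
    exact absurd hm this.not_gt
  -- For `w` in the ball of radius `m` around 0, the ball of radius `2 * m` around `w` contains that
  -- whole ball, so `w` is heavy.
  refine ⟨2 * m, lt_of_lt_of_le (lt_trans (by simp) hhalf) (measure_mono fun w hw => ?_)⟩
  refine hhalf.trans_le (measure_mono fun u hu n => ?_)
  have h1 := abs_le.1 (hu n)
  have h2 := abs_le.1 (hw n)
  simp only [ZeroMemClass.coe_zero, Pi.zero_apply, sub_zero] at h1 h2
  push_cast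
  exact abs_le.2 ⟨by linarith, by linarith⟩

/-- Two balls of mass more than `1 / 2` must meet. Hence heavy sets are bounded, and coordinates are
integrable over them for every `μ`. -/
lemma abs_sub_le_of_mem_heavySet {f : ℤ[X]} {μ : Measure (W0 f)} [IsProbabilityMeasure μ] {R : ℕ}
    {u w : W0 f} (hu : u ∈ heavySet f μ R) (hw : w ∈ heavySet f μ R) (n : ℤ) :
    |u.1 n - w.1 n| ≤ 2 * R := by
  obtain ⟨z, hz1, hz2⟩ : (supBall f R u ∩ supBall f R w).Nonempty := by
    by_contra hne
    rw [Set.not_nonempty_iff_eq_empty, ← Set.disjoint_iff_inter_eq_empty] at hne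
    have h1 : μ (supBall f R u ∪ supBall f R w) ≤ 1 := prob_le_one
    rw [measure_union hne (isClosed_supBall f R w).measurableSet] at h1
    have h2 := ENNReal.add_lt_add hu hw
    rw [ENNReal.inv_two_add_inv_two] at h2
    exact absurd h1 h2.not_ge
  have h1 := abs_le.1 (hz1 n)
  have h2 := abs_le.1 (hz2 n)
  exact abs_le.2 ⟨by linarith, by linarith⟩

lemma exists_bound_heavySet (f : ℤ[X]) (μ : Measure (W0 f)) [IsProbabilityMeasure μ] (R : ℕ) :
    ∃ C : ℝ, ∀ w ∈ heavySet f μ R, ∀ n, |w.1 n| ≤ C := by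
  rcases (heavySet f μ R).eq_empty_or_nonempty with h | ⟨w₀, hw₀⟩
  · exact ⟨0, by simp [h]⟩
  · obtain ⟨C, hC⟩ := w₀.2.1
    refine ⟨2 * R + C, fun w hw n => ?_⟩
    have := abs_sub_abs_le_abs_sub (w.1 n) (w₀.1 n)
    linarith [abs_sub_le_of_mem_heavySet hw hw₀ n, hC n]

lemma integrableOn_heavySet (f : ℤ[X]) (μ : Measure (W0 f)) [IsProbabilityMeasure μ] (R : ℕ)
    (n : ℤ) : IntegrableOn (fun w : W0 f => w.1 n) (heavySet f μ R) μ := by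
  obtain ⟨C, hC⟩ := exists_bound_heavySet f μ R
  refine Measure.integrableOn_of_bounded (M := C) (measure_ne_top _ _)
    (measurable_coord f n).aestronglyMeasurable ?_
  exact (ae_restrict_iff' (measurableSet_heavySet f μ R)).2 (ae_of_all _ fun w hw => hC w hw n)

/-- The average of `w` over the points `w` in `heavySet f μ R`. -/
noncomputable def heavyMean (f : ℤ[X]) (μ : Measure (W0 f)) (R : ℕ) (n : ℤ) : ℝ :=
  (μ.real (heavySet f μ R))⁻¹ * ∫ w in heavySet f μ R, w.1 n ∂μ

/-- The finite linear relation `f(σ) w = 0` passes through the integral. A null heavy set is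
harmless: the convention `0⁻¹ = 0` makes its mean zero. -/
lemma heavyMean_mem (f : ℤ[X]) (μ : Measure (W0 f)) [IsProbabilityMeasure μ] (R : ℕ) :
    heavyMean f μ R ∈ W0 f := by
  constructor
  · obtain ⟨C, hC⟩ := exists_bound_heavySet f μ R
    refine ⟨(μ.real (heavySet f μ R))⁻¹ * (C * μ.real (heavySet f μ R)), fun n => ?_⟩
    rw [heavyMean, abs_mul, abs_of_nonneg (inv_nonneg.2 measureReal_nonneg)]
    refine mul_le_mul_of_nonneg_left ?_ (inv_nonneg.2 measureReal_nonneg)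
    exact norm_setIntegral_le_of_norm_le_const (f := fun w : W0 f => w.1 n) (measure_lt_top _ _)
      fun w hw => hC w hw n
  · ext n
    have h : ∀ k ∈ f.support, f.coeff k • heavyMean f μ R (n + k) =
        (μ.real (heavySet f μ R))⁻¹ *
          ∫ w in heavySet f μ R, f.coeff k • w.1 (n + k) ∂μ := by
      intro k _
      simp only [heavyMean, zsmul_eq_mul, integral_const_mul]
      ring
    rw [polyShift_apply, Finset.sum_congr rfl h, ← Finset.mul_sum, ← integral_finsetSum]
    · have h0 : ∀ w : W0 f, ∑ k ∈ f.support, f.coeff k • w.1 (n + k) = 0 := fun w =>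
        congrFun w.2.2 n
      simp only [h0, integral_zero, mul_zero, Pi.zero_apply]
    · intro k _
      simp only [zsmul_eq_mul]
      exact (integrableOn_heavySet f μ R _).const_mul _

lemma measurable_heavyMean_kernel {α : Type*} [MeasurableSpace α] (f : ℤ[X])
    (κ : Kernel α (W0 f)) [IsMarkovKernel κ] (R : ℕ) (n : ℤ) :
    Measurable fun a => heavyMean f (κ a) R n := by
  have hS := measurableSet_heavySet_kernel f κ R
  refine Measurable.mul (Measurable.inv ?_) ?_
  · exact (Kernel.measurable_kernel_prodMk_left hS).ennreal_toReal
  · have hg : StronglyMeasurable fun p : α × W0 f =>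
        {p : α × W0 f | p.2 ∈ heavySet f (κ p.1) R}.indicator (fun p => p.2.1 n) p :=
      (((measurable_coord f n).comp measurable_snd).indicator hS).stronglyMeasurable
    simp only [← integral_indicator (measurableSet_heavySet f (κ _) R)]
    exact (hg.integral_kernel_prod_right' (κ := κ)).measurable

open Classical in
/-- A center of the probability measure `μ` on `W_f^{(0)}`: the average over `heavySet f μ R`, for
the least `R` for which this set is not null. -/
noncomputable def center (f : ℤ[X]) (μ : Measure (W0 f)) [IsProbabilityMeasure μ] : W0 f :=
  ⟨heavyMean f μ (Nat.find (exists_heavySet_pos f μ)), heavyMean_mem f μ _⟩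

lemma measurable_center_kernel {α : Type*} [MeasurableSpace α] (f : ℤ[X])
    (κ : Kernel α (W0 f)) [IsMarkovKernel κ] : Measurable fun a => center f (κ a) := by
  classical
  refine Measurable.subtype_mk (measurable_pi_iff.2 fun n => ?_)
  -- The radius varies with `a`, but the parameter space splits into countably many measurable
  -- pieces on which it is constant.
  refine Measurable.find (f := fun R a => heavyMean f (κ a) R n)
    (p := fun R a => 0 < κ a (heavySet f (κ a) R))
    (fun R => measurable_heavyMean_kernel f κ R n) (fun R => ?_)
    fun a => exists_heavySet_pos f (κ a)
  exact measurableSet_lt measurable_const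
    (Kernel.measurable_kernel_prodMk_left (measurableSet_heavySet_kernel f κ R))

/-- The affine map `w ↦ σ w + d` of `W_f^{(0)}`. -/
def affineShift (f : ℤ[X]) (d w : W0 f) : W0 f := shiftW0 f w + d

lemma measurable_affineShift (f : ℤ[X]) (d : W0 f) : Measurable (affineShift f d) :=
  ((continuous_shiftW0 f).add continuous_const).measurable

lemma affineShift_apply (f : ℤ[X]) (d w : W0 f) (n : ℤ) :
    (affineShift f d w).1 n = w.1 (n + 1) + d.1 n := rfl

/-- The translation by `d` cancels in differences and the shift only permutes coordinates, so the
map is a sup-norm isometry. -/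
lemma affineShift_preimage_supBall (f : ℤ[X]) (d w : W0 f) (R : ℝ) :
    affineShift f d ⁻¹' supBall f R (affineShift f d w) = supBall f R w := by
  ext u
  simp only [Set.mem_preimage, supBall, Set.mem_ofPred_eq, affineShift_apply, add_sub_add_right_eq_sub]
  exact ⟨fun h n => by simpa using h (n - 1), fun h n => h (n + 1)⟩

lemma affineShift_preimage_heavySet (f : ℤ[X]) (d : W0 f) (μ : Measure (W0 f)) (R : ℕ) :
    affineShift f d ⁻¹' heavySet f (μ.map (affineShift f d)) R = heavySet f μ R := by
  ext w
  simp only [Set.mem_preimage, heavySet, Set.mem_ofPred_eq]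
  rw [Measure.map_apply (measurable_affineShift f d) (isClosed_supBall _ _ _).measurableSet,
    affineShift_preimage_supBall]

/-- An isometry matches the heavy sets of `μ` and of its image, with equal masses, so the least
radius agrees. Normalized averages commute with affine maps. -/
lemma center_map_affineShift (f : ℤ[X]) (d : W0 f) (μ μ' : Measure (W0 f))
    [IsProbabilityMeasure μ] [IsProbabilityMeasure μ'] (h : μ' = μ.map (affineShift f d)) :
    center f μ' = affineShift f d (center f μ) := by
  classical
  have hpre : ∀ R, affineShift f d ⁻¹' heavySet f μ' R = heavySet f μ R := fun R => by
    rw [h, affineShift_preimage_heavySet]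
  have hmeas : ∀ R, μ' (heavySet f μ' R) = μ (heavySet f μ R) := fun R => by
    rw [← hpre, ← Measure.map_apply (measurable_affineShift f d) (measurableSet_heavySet f μ' R),
      ← h]
  have hfind : Nat.find (exists_heavySet_pos f μ') = Nat.find (exists_heavySet_pos f μ) := by
    simp only [hmeas]
  refine Subtype.ext (funext fun n => ?_)
  rw [affineShift_apply]
  simp only [center, hfind]
  set R := Nat.find (exists_heavySet_pos f μ)
  have hpos : 0 < μ (heavySet f μ R) := Nat.find_spec (exists_heavySet_pos f μ)
  have hreal : μ.real (heavySet f μ R) ≠ 0 :=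
    (ENNReal.toReal_pos hpos.ne' (measure_ne_top _ _)).ne'
  have hmean : heavyMean f μ' R n = (μ.real (heavySet f μ R))⁻¹ *
      ∫ w in heavySet f μ R, (w.1 (n + 1) + d.1 n) ∂μ := by
    rw [heavyMean, Measure.real, hmeas, ← Measure.real]
    congr 1
    subst h
    rw [setIntegral_map (measurableSet_heavySet f _ R)
      (measurable_coord f n).aestronglyMeasurable (measurable_affineShift f d).aemeasurable, hpre]
    rfl
  rw [hmean, integral_add (integrableOn_heavySet f μ R _) (integrable_const _), setIntegral_const,
    smul_eq_mul, mul_add, inv_mul_cancel_left₀ hreal]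
  rfl

/-! ### Disintegration of invariant measures of the skew product -/

lemma exists_coboundary_of_invariant (f : ℤ[X]) (ν : Measure BddIntSeq)
    (hν : MeasurePreserving (shiftInt 1) ν ν) (νt : Measure (YTilde f)) [IsProbabilityMeasure νt]
    (hνt : MeasurePreserving (sigmaTilde f) νt νt) (hfst : νt.map Prod.fst = ν) :
    ∃ b : BddIntSeq → W0 f, Measurable b ∧
      ∀ᵐ v ∂ν, cocycle f 1 v = b (shiftInt 1 v) - shiftW0 f (b v) := by
  have hfst' : νt.fst = ν := hfst
  have : IsProbabilityMeasure ν := hfst ▸ Measure.isProbabilityMeasure_map measurable_fst.aemeasurable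
  set κ := νt.condKernel
  have hσ : Measurable (sigmaTilde f) := hνt.measurable
  -- The transported fibre measures: at `σ v`, the image of `κ v` under the fibre map of `sigmaTilde
  -- f`.
  let η : Kernel BddIntSeq (W0 f) := ((Kernel.id ×ₖ κ).map (fun y => (sigmaTilde f y).2)).comap
    (shiftInt (-1)) (continuous_shiftInt (-1)).measurable
  have hη : ∀ v, η (shiftInt 1 v) = (κ v).map (affineShift f (cocycle f 1 v)) := by
    intro v
    rw [Kernel.comap_apply, shiftInt_comp, neg_add_cancel, shiftInt_zero,
      Kernel.map_apply _ hσ.snd, Kernel.prod_apply, Kernel.id_apply, Measure.dirac_prod,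
      Measure.map_map hσ.snd measurable_prodMk_left]
    rfl
  have hηfin : IsMarkovKernel η := by
    have := Kernel.IsMarkovKernel.map (Kernel.id ×ₖ κ) hσ.snd
    infer_instance
  have hdis : νt = ν ⊗ₘ κ := by
    rw [← hfst']
    exact (νt.disintegrate νt.condKernel).symm
  -- Invariance of `νt` under `sigmaTilde f` means exactly that `η` disintegrates it as well.
  have hdis' : νt = ν ⊗ₘ η := by
    ext s hs
    rw [← hνt.measure_preimage hs.nullMeasurableSet, Measure.compProd_apply hs,
      ← hν.lintegral_comp (Kernel.measurable_kernel_prodMk_left hs)]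
    conv_lhs => rw [hdis]
    rw [Measure.compProd_apply (hσ hs)]
    refine lintegral_congr fun v => ?_
    rw [hη, Measure.map_apply (measurable_affineShift f _) (measurable_prodMk_left hs)]
    rfl
  have hae : ∀ᵐ v ∂ν, η v = κ v := by
    rw [← hfst'] at hdis' ⊢
    exact eq_condKernel_of_measure_eq_compProd η hdis'
  refine ⟨fun v => center f (κ v), measurable_center_kernel f κ, ?_⟩
  -- The equality of kernels is needed at `σ v`, so the null set is pulled back by the shift.
  filter_upwards [hν.quasiMeasurePreserving.ae hae] with v hv
  rw [hη] at hv
  rw [center_map_affineShift f (cocycle f 1 v) (κ v) (κ (shiftInt 1 v)) hv.symm, affineShift,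
    add_sub_cancel_left]

/-! ### Consequences of the coboundary equation -/

section Coboundary

variable {f : ℤ[X]} {ν : Measure BddIntSeq} {b : BddIntSeq → W0 f}

/-- Off the countable union of shifted exceptional sets, the coboundary equation holds along the
whole orbit of `v`. Induction in both directions then gives equivariance of `xiBar f v + b v` under
every power of the shift. -/
lemma ae_cocycle_eq (hν : MeasurePreserving (shiftInt 1) ν ν)
    (hcob : ∀ᵐ v ∂ν, cocycle f 1 v = b (shiftInt 1 v) - shiftW0 f (b v)) :
    ∀ᵐ v ∂ν, ∀ k n : ℤ, (cocycle f k v).1 n = (b (shiftInt k v)).1 n - (b v).1 (n + k) := by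
  have hall : ∀ᵐ v ∂ν, ∀ k : ℤ, cocycle f 1 (shiftInt k v) =
      b (shiftInt 1 (shiftInt k v)) - shiftW0 f (b (shiftInt k v)) :=
    ae_all_iff.2 fun k => (measurePreserving_shiftInt hν k).quasiMeasurePreserving.ae hcob
  filter_upwards [hall] with v hv
  have hstep : ∀ k n : ℤ, xiBar f (shiftInt k v) (n + 1) + (b (shiftInt k v)).1 (n + 1) =
      xiBar f (shiftInt (1 + k) v) n + (b (shiftInt (1 + k) v)).1 n := by
    intro k n
    have h := congrFun (congrArg Subtype.val (hv k)) n
    simp only [shiftInt_comp, cocycle, dSeq, shift, Pi.sub_apply, shiftW0,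
      AddSubgroupClass.coe_sub] at h
    linarith
  have hη : ∀ k n : ℤ, xiBar f (shiftInt k v) n + (b (shiftInt k v)).1 n =
      xiBar f v (n + k) + (b v).1 (n + k) := by
    intro k
    induction k with
    | zero => simp [shiftInt_zero]
    | succ k ih =>
      intro n
      rw [add_comm (k : ℤ) 1, ← hstep, ih, add_assoc]
    | pred k ih =>
      intro n
      have h := hstep (-k - 1) (n - 1)
      rw [sub_add_cancel, add_sub_cancel] at h
      rw [h, ih]
      ring_nf
  intro k n
  have h := hη k n
  simp only [cocycle, dSeq, shift, Pi.sub_apply]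
  linarith

lemma cocycle_tight_of_coboundary [IsProbabilityMeasure ν]
    (hν : MeasurePreserving (shiftInt 1) ν ν) (hb : Measurable b)
    (hcob : ∀ᵐ v ∂ν, cocycle f 1 v = b (shiftInt 1 v) - shiftW0 f (b v)) {ε : ℝ} (hε : 0 < ε) :
    ∃ C : Set (W0 f), IsCompact C ∧ ∀ k : ℤ, 1 - ε < ν.real {v | cocycle f k v ∈ C} := by
  have hBm : ∀ m : ℕ, MeasurableSet (b ⁻¹' supBall f m 0) := fun m =>
    hb (isClosed_supBall f m 0).measurableSet
  obtain ⟨m, hm⟩ := exists_measure_compl_lt ν (s := fun m : ℕ => b ⁻¹' supBall f m 0) hBm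
    (fun i j hij => Set.preimage_mono (supBall_mono f (by exact_mod_cast hij) 0))
    (fun v => exists_mem_supBall_zero (b v)) (ENNReal.ofReal_pos.2 (half_pos hε))
  -- `d(k, v)` is a difference of two sequences bounded by `m`.
  refine ⟨supBall f (2 * m) 0, isCompact_supBall_zero f _, fun k => ?_⟩
  have hCm : MeasurableSet {v | cocycle f k v ∈ supBall f (2 * m) 0} :=
    measurable_cocycle f k (isClosed_supBall f _ 0).measurableSet
  have hsub : ({v | cocycle f k v ∈ supBall f (2 * m) 0}ᶜ : Set BddIntSeq) ≤ᵐ[ν]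
      (shiftInt k ⁻¹' (b ⁻¹' supBall f m 0)ᶜ ∪ (b ⁻¹' supBall f m 0)ᶜ : Set BddIntSeq) := by
    filter_upwards [ae_cocycle_eq hν hcob] with v hv hmem
    by_contra hcon
    have hcon' : b (shiftInt k v) ∈ supBall f m 0 ∧ b v ∈ supBall f m 0 := by
      by_contra h
      rw [not_and_or] at h
      exact hcon h
    refine hmem fun n => ?_
    have h1 := hcon'.1 n
    have h2 := hcon'.2 (n + k)
    simp only [ZeroMemClass.coe_zero, Pi.zero_apply, sub_zero] at h1 h2 ⊢
    rw [hv k n]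
    exact (abs_sub _ _).trans (by linarith)
  have hlt : ν {v | cocycle f k v ∈ supBall f (2 * m) 0}ᶜ < ENNReal.ofReal ε := by
    refine (measure_mono_ae hsub).trans_lt ((measure_union_le _ _).trans_lt ?_)
    rw [(measurePreserving_shiftInt hν k).measure_preimage (hBm m).compl.nullMeasurableSet,
      ← add_halves ε, ENNReal.ofReal_add (half_pos hε).le (half_pos hε).le]
    exact ENNReal.add_lt_add hm hm
  rw [← ofReal_measureReal, ENNReal.ofReal_lt_ofReal_iff hε, probReal_compl_eq_one_sub hCm] at hlt
  linarith

/-! ### The corrected coding map and its image measure -/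

lemma measurable_xiStarB (hf : IsNormalizedIrreducible f) (hb : Measurable b) :
    Measurable (xiStarB hf b) := by
  have h : ∀ n : ℤ, Measurable fun v => xiBar f v n + (b v).1 n := fun n =>
    ((measurable_pi_apply n).comp (measurable_xiBar f)).add ((measurable_coord f n).comp hb)
  refine measurable_comap_iff.2 (measurable_pi_iff.2 fun n => ?_)
  exact (AddCircle.continuous_mk' (1 : ℝ)).measurable.comp (h n)

lemma xiStarB_sub_mem (hf : IsNormalizedIrreducible f) (v : BddIntSeq) :
    xiStarB hf b v - xiStar hf v ∈ X0 f := by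
  rw [xiStarB, add_sub_cancel_left]
  exact ⟨b v, rfl⟩

/-- The equivariance already holds for the real sequences `xiBar f v + b v`, before reduction modulo
one. -/
lemma ae_xiStarB_shiftInt (hf : IsNormalizedIrreducible f)
    (hcob : ∀ᵐ v ∂ν, cocycle f 1 v = b (shiftInt 1 v) - shiftW0 f (b v)) :
    ∀ᵐ v ∂ν, xiStarB hf b (shiftInt 1 v) = alpha f (xiStarB hf b v) := by
  filter_upwards [hcob] with v hv
  refine Subtype.ext (funext fun n => ?_)
  have h := congrFun (congrArg Subtype.val hv) n
  simp only [cocycle, dSeq, shift, Pi.sub_apply, shiftW0, AddSubgroupClass.coe_sub] at h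
  have h' : xiBar f (shiftInt 1 v) n + (b (shiftInt 1 v)).1 n =
      xiBar f v (n + 1) + (b v).1 (n + 1) := by linarith
  exact congrArg (fun x : ℝ => (x : UnitAddCircle)) h'

lemma measurable_alpha (f : ℤ[X]) : Measurable (alpha f) :=
  measurable_comap_iff.2 (measurable_pi_iff.2 fun n =>
    (measurable_pi_apply (n + 1)).comp measurable_subtype_coe)

lemma measurePreserving_alpha_map (hf : IsNormalizedIrreducible f)
    (hν : MeasurePreserving (shiftInt 1) ν ν) (hb : Measurable b)
    (hcob : ∀ᵐ v ∂ν, cocycle f 1 v = b (shiftInt 1 v) - shiftW0 f (b v)) :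
    MeasurePreserving (alpha f) (ν.map (xiStarB hf b)) (ν.map (xiStarB hf b)) := by
  have hm := measurable_xiStarB hf hb
  refine ⟨measurable_alpha f, ?_⟩
  have h : alpha f ∘ xiStarB hf b =ᵐ[ν] xiStarB hf b ∘ shiftInt 1 :=
    (ae_xiStarB_shiftInt hf hcob).mono fun v hv => hv.symm
  rw [Measure.map_map (measurable_alpha f) hm, Measure.map_congr h,
    ← Measure.map_map hm hν.measurable, hν.map_eq]

end Coboundary

end NonexpansiveCoding

theorem theoremt (f : ℤ[X]) (hf : IsNormalizedIrreducible f) (hnonhyp : IsNonhyperbolic f)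
    (hnoncyc : ¬ IsCyclotomic f)
    (ν : Measure BddIntSeq) [IsProbabilityMeasure ν] (hν : MeasurePreserving (shiftInt 1) ν ν) :
    List.TFAE [
      ∃ νt : Measure (YTilde f), IsProbabilityMeasure νt ∧
        MeasurePreserving (sigmaTilde f) νt νt ∧ νt.map Prod.fst = ν,
      ∀ ε : ℝ, 0 < ε → ∃ C : Set (W0 f), IsCompact C ∧
        ∀ k : ℤ, 1 - ε < ν.real {v | cocycle f k v ∈ C},
      ∃ b : BddIntSeq → W0 f, Measurable b ∧
        ∀ᵐ v ∂ν, cocycle f 1 v = b (shiftInt 1 v) - shiftW0 f (b v)] ∧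
    ∀ b : BddIntSeq → W0 f, Measurable b →
      (∀ᵐ v ∂ν, cocycle f 1 v = b (shiftInt 1 v) - shiftW0 f (b v)) →
      Measurable (xiStarB hf b) ∧
      (∀ v, xiStarB hf b v - xiStar hf v ∈ X0 f) ∧
      (∀ᵐ v ∂ν, xiStarB hf b (shiftInt 1 v) = alpha f (xiStarB hf b v)) ∧
      IsProbabilityMeasure (ν.map (xiStarB hf b)) ∧
      MeasurePreserving (alpha f) (ν.map (xiStarB hf b)) (ν.map (xiStarB hf b)) := by
  refine ⟨?_, fun b hb hcob => ⟨measurable_xiStarB hf hb, xiStarB_sub_mem hf,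
    ae_xiStarB_shiftInt hf hcob,
    Measure.isProbabilityMeasure_map (measurable_xiStarB hf hb).aemeasurable,
    measurePreserving_alpha_map hf hν hb hcob⟩⟩
  tfae_have 1 → 3 := fun ⟨νt, _, hνt, hfst⟩ => exists_coboundary_of_invariant f ν hν νt hνt hfst
  tfae_have 3 → 2 := fun ⟨_, hb, hcob⟩ _ hε => cocycle_tight_of_coboundary hν hb hcob hε
  tfae_have 2 → 1 := exists_invariant_of_cocycle_tight f ν hν
  tfae_finish
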